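/- Let $N\in\mathbb N$ and let $c_1,\dots,c_N$ be operators on a non-zero finite-dimensional complex Hilbert space $\mathbb H$ (for instance $\mathbb H=(\mathbb C^2)^{\otimes N}$) which, together with their adjoints, satisfy the canonical anti-commutation relations $$c_ic_j+c_jc_i=0,\qquad c_i^*c_j^*+c_j^*c_i^*=0,\qquad c_ic_j^*+c_j^*c_i=\delta_{ij}\,\mathbb I .$$ Let $\mathbf M,\mathbf\Delta\in\mathbb C^{N\times N}$ with $\mathbf M=\mathbf M^*$ and $\mathbf\Delta^\top=-\mathbf\Delta$, and define the Bogoliubov-de Gennes Hamiltonian, an operator on $\mathbb H$, and its $2N\times 2N$ matrix by $$H_{\mathrm{BdG}}=\frac12\sum_{i,j=1}^N \mathbf M_{ij}(c_i^*c_j-c_jc_i^*)+\frac12\sum_{i,j=1}^N\left(\mathbf\Delta_{ij}c_i^*c_j^*-\overline{\mathbf\Delta_{ij}}\,c_ic_j\right),\qquad \mathbf H_{\mathrm{BdG}}=\begin{pmatrix}-\overline{\mathbf M}&-\overline{\mathbf\Delta}\\ \mathbf\Delta&\mathbf M\end{pmatrix}.$$ Let $\beta>0$, let $\rho=Z^{-1}\exp(-\beta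 H_{\mathrm{BdG}})$ with $Z=\operatorname{tr}\exp(-\beta H_{\mathrm{BdG}})$, write $\langle A\rangle_\rho=\operatorname{tr}(\rho A)$ for an operator $A$ on $\mathbb H$, and let $$\mathbf S=\begin{pmatrix}(\langle c_ic_j^*\rangle_\rho)_{i,j}&(\langle c_ic_j\rangle_\rho)_{i,j}\\ (\langle c_i^*c_j^*\rangle_\rho)_{i,j}&(\langle c_i^*c_j\rangle_\rho)_{i,j}\end{pmatrix}.$$ Let $\sigma(x)=1/(1+e^{-x})$, let $\mathbf C=\begin{pmatrix}\mathbf 0&\mathbf I\\ \mathbf I&\mathbf 0\end{pmatrix}$, let $\overline{\,\cdot\,}$ denote entrywise complex conjugation, and let $\preceq$ be the order in which $\mathbf A\preceq\mathbf B$ means that $\mathbf B-\mathbf A$ is Hermitian positive semidefinite. Then: 1. There are a unitary $2N\times 2N$ matrix $\mathbf W$ with $\mathbf W^\top\mathbf C\mathbf W=\mathbf C$ and real numbers $0\le\epsilon_1\le\dots\le\epsilon_N$ such that $$\mathbf H_{\mathrm{BdG}}=\mathbf W^*\begin{pmatrix}\mathrm{Diag}(-\epsilon_k)&\mathbf 0\\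 \mathbf 0&\mathrm{Diag}(\epsilon_k)\end{pmatrix}\mathbf W,$$ and for every such $\mathbf W$ and $\epsilon_1,\dots,\epsilon_N$, $$\mathbf S=\overline{\mathbf W}^{*}\begin{pmatrix}\mathrm{Diag}(\sigma(\beta\epsilon_k))&\mathbf 0\\ \mathbf 0&\mathrm{Diag}(\sigma(-\beta\epsilon_k))\end{pmatrix}\overline{\mathbf W}.$$ 2. $\mathbf S=\sigma(-\beta\,\overline{\mathbf H_{\mathrm{BdG}}})$, where $\sigma$ is applied to a Hermitian matrix by the spectral functional calculus. 3. $\mathbf 0\preceq\mathbf S\preceq\mathbf I$. 4. $\mathbf C\overline{\mathbf S}\mathbf C=\mathbf I-\mathbf S$. -/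

import Mathlib

open scoped Matrix ComplexOrder

noncomputable section

namespace BdG

section Operators

variable {ℍ : Type*} [NormedAddCommGroup ℍ] [InnerProductSpace ℂ ℍ] [CompleteSpace ℍ] {N : ℕ}

/-- The canonical anti-commutation relations for operators `c 1, …, c N` on a Hilbert space and
their adjoints (`star` is the adjoint, `*` is composition). -/
structure SatisfiesCAR (c : Fin N → (ℍ →L[ℂ] ℍ)) : Prop where
  anticomm : ∀ i j, c i * c j + c j * c i = 0
  anticomm_star : ∀ i j, star (c i) * star (c j) + star (c j) * star (c i) = 0
  anticomm_mixed : ∀ i j, c i * star (c j) + star (c j) * c i = if i = j then 1 else 0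

/-- The Bogoliubov-de Gennes Hamiltonian
`½ ∑ M i j (cᵢ* cⱼ - cⱼ cᵢ*) + ½ ∑ (Δ i j cᵢ* cⱼ* - conj (Δ i j) cᵢ cⱼ)`, an operator on `ℍ`. -/
def hamiltonian (M Δ : Matrix (Fin N) (Fin N) ℂ) (c : Fin N → (ℍ →L[ℂ] ℍ)) : ℍ →L[ℂ] ℍ :=
  (1 / 2 : ℂ) • ∑ i, ∑ j, M i j • (star (c i) * c j - c j * star (c i)) +
    (1 / 2 : ℂ) • ∑ i, ∑ j, (Δ i j • (star (c i) * star (c j)) - star (Δ i j) • (c i * c j))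

/-- The trace of an operator on a finite-dimensional space. -/
def tr (A : ℍ →L[ℂ] ℍ) : ℂ := LinearMap.trace ℂ ℍ (A : ℍ →ₗ[ℂ] ℍ)

/-- The Gibbs state `Z⁻¹ exp (-β H)`, with `Z = tr exp (-β H)`. -/
def gibbs (β : ℝ) (H : ℍ →L[ℂ] ℍ) : ℍ →L[ℂ] ℍ :=
  (tr (NormedSpace.exp (-(β : ℂ) • H)))⁻¹ • NormedSpace.exp (-(β : ℂ) • H)

/-- The expectation value `⟨A⟩_ρ = tr (ρ A)`. -/
def expectation (ρ A : ℍ →L[ℂ] ℍ) : ℂ := tr (ρ * A)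

/-- The `2N × 2N` matrix of two-point expectations, with blocks
`⟨cᵢ cⱼ*⟩`, `⟨cᵢ cⱼ⟩`, `⟨cᵢ* cⱼ*⟩`, `⟨cᵢ* cⱼ⟩`. -/
def twoPoint (ρ : ℍ →L[ℂ] ℍ) (c : Fin N → (ℍ →L[ℂ] ℍ)) :
    Matrix (Fin N ⊕ Fin N) (Fin N ⊕ Fin N) ℂ :=
  Matrix.fromBlocks
    (Matrix.of fun i j => expectation ρ (c i * star (c j)))
    (Matrix.of fun i j => expectation ρ (c i * c j))
    (Matrix.of fun i j => expectation ρ (star (c i) * star (c j)))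
    (Matrix.of fun i j => expectation ρ (star (c i) * c j))

end Operators

section Matrices

variable {N : ℕ}

/-- Entrywise complex conjugation (no transposition). -/
def conj {n : Type*} (A : Matrix n n ℂ) : Matrix n n ℂ := A.map star

/-- The block matrix of the Hamiltonian, with rows `(-conj M, -conj Δ)` and `(Δ, M)`. -/
def hamiltonianMatrix (M Δ : Matrix (Fin N) (Fin N) ℂ) :
    Matrix (Fin N ⊕ Fin N) (Fin N ⊕ Fin N) ℂ :=
  Matrix.fromBlocks (-conj M) (-conj Δ) Δ M

/-- The particle-hole involution, with rows `(0, I)` and `(I, 0)`. -/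
def flip (N : ℕ) : Matrix (Fin N ⊕ Fin N) (Fin N ⊕ Fin N) ℂ :=
  Matrix.fromBlocks 0 1 1 0

/-- `Diag(x, y)` for real vectors `x` and `y`. -/
def blockDiag (x y : Fin N → ℝ) : Matrix (Fin N ⊕ Fin N) (Fin N ⊕ Fin N) ℂ :=
  Matrix.fromBlocks (Matrix.diagonal fun k => (x k : ℂ)) 0 0 (Matrix.diagonal fun k => (y k : ℂ))

/-- `W` and `ε` form a Bogoliubov diagonalization of the block matrix of the Hamiltonian:
`W` is a unitary orthogonal complex matrix, `0 ≤ ε 1 ≤ … ≤ ε N`, and the block matrix equals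
`W* Diag(-ε, ε) W`. -/
structure IsDiagonalization (M Δ : Matrix (Fin N) (Fin N) ℂ)
    (W : Matrix (Fin N ⊕ Fin N) (Fin N ⊕ Fin N) ℂ) (ε : Fin N → ℝ) : Prop where
  unitary : W ∈ Matrix.unitaryGroup (Fin N ⊕ Fin N) ℂ
  orthogonal : Wᵀ * flip N * W = flip N
  nonneg : ∀ k, 0 ≤ ε k
  monotone : Monotone ε
  eq : hamiltonianMatrix M Δ = Wᴴ * blockDiag (fun k => -ε k) ε * W

end Matrices

end BdG

end

/-! The block matrix `A` of the Hamiltonian anticommutes with the antiunitary involution J x = C x̄,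
so J exchanges the eigenspaces of r and -r. Taking eigenvectors v with r ≥ 0, each orthogonal to all
conjugates J v, gives a unitary whose columns are permuted by J, which is the condition Wᵀ C W = C
(`exists_isDiagonalization`). Only the kernel needs care: there an isotropic vector comes from a
complex quadratic equation.

By the anticommutation relations, the commutator with H acts on the Nambu vector through `A`, so the
operators b_k built from eigenvectors of `A` satisfy [H, b_k] = D_k b_k. Hence exp(-βH) b_k = q b_k
exp(-βH) with q = exp(-βD_k). Cyclicity of the trace and {b_k, b_l*} = δ_kl then give ⟨b_k b_l*⟩ =
δ_kl q/(1+q) = δ_kl σ(-βD_k) (`SatisfiesCAR.tr_gibbs_mul_quasi`). Undoing the change of basis yields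
S, and the other claims follow from this formula. -/

namespace BdG

/-! ### Symmetric operators anticommuting with a conjugation -/

section Conjugation

variable {E : Type*} [NormedAddCommGroup E] [InnerProductSpace ℂ E]

/-- An antiunitary involution. -/
structure IsConjugation (J : E →ₛₗ[starRingEnd ℂ] E) : Prop where
  involutive : ∀ x, J (J x) = x
  inner_map_map : ∀ x y, inner ℂ (J x) (J y) = inner ℂ y x

/-- Thus ⟨x, J y⟩ is a symmetric form, conjugate-linear in both arguments, and isotropy is a
quadratic equation. -/
lemma IsConjugation.inner_map_right {J : E →ₛₗ[starRingEnd ℂ] E} (hJ : IsConjugation J) (x y : E) :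
    inner ℂ x (J y) = inner ℂ y (J x) := by
  rw [← hJ.inner_map_map _ x, hJ.involutive]

/-- Here `J v` is an eigenvector for -r ≠ r, and eigenspaces of a symmetric operator are orthogonal.
-/
lemma IsConjugation.inner_map_self_eq_zero {J : E →ₛₗ[starRingEnd ℂ] E} {T : E →ₗ[ℂ] E}
    (hT : T.IsSymmetric) (hTJ : ∀ x, T (J x) = -J (T x)) {v : E} {r : ℝ} (hr : r ≠ 0)
    (hv : T v = (r : ℂ) • v) : inner ℂ v (J v) = 0 := by
  have h := hT v (J v)
  rw [hTJ, hv, map_smulₛₗ, inner_smul_left, inner_neg_right, inner_smul_right, Complex.conj_ofReal]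
    at h
  have h2 : (r : ℂ) * inner ℂ v (J v) = 0 := by linear_combination h / 2
  simpa [hr] using h2

/-- A subspace of dimension at least two contains an isotropic vector. -/
lemma IsConjugation.exists_isotropic {J : E →ₛₗ[starRingEnd ℂ] E} (hJ : IsConjugation J)
    {K : Submodule ℂ E} (hK : 2 ≤ Module.finrank ℂ K) :
    ∃ v ∈ K, v ≠ 0 ∧ inner ℂ v (J v) = 0 := by
  have : Nontrivial K := Module.nontrivial_of_finrank_pos (R := ℂ) (by lia)
  obtain ⟨y, hy⟩ := exists_ne (0 : K)
  by_cases hyy : inner ℂ (y : E) (J y) = 0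
  · exact ⟨y, y.2, by simpa using hy, hyy⟩
  obtain ⟨x, hx⟩ : ∃ x : K, x ∉ Submodule.span ℂ {y} := by
    by_contra! hcon
    have htop : Submodule.span ℂ {y} = ⊤ := Submodule.eq_top_iff'.mpr hcon
    have := finrank_span_singleton (K := ℂ) hy
    rw [htop, finrank_top] at this
    lia
  obtain ⟨s, hs⟩ := IsAlgClosed.exists_pow_nat_eq
    (discrim (inner ℂ (y : E) (J y)) (2 * inner ℂ (x : E) (J y)) (inner ℂ (x : E) (J x)))
    (n := 2) (by norm_num)
  obtain ⟨t, ht⟩ := exists_quadratic_eq_zero hyy ⟨s, by rw [← hs, sq]⟩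
  -- Conjugate-linearity of the form makes the conjugate of the root the right coefficient; the
  -- vector is nonzero because `x` is not a multiple of `y`.
  refine ⟨x + (starRingEnd ℂ t) • y, K.add_mem x.2 (K.smul_mem _ y.2), fun h0 => hx ?_, ?_⟩
  · rw [Submodule.mem_span_singleton]
    refine ⟨-(starRingEnd ℂ t), ?_⟩
    ext
    rw [neg_smul, Submodule.coe_neg, Submodule.coe_smul]
    exact (eq_neg_of_add_eq_zero_left h0).symm
  · rw [map_add, map_smulₛₗ, inner_add_left, inner_add_right, inner_add_right, inner_smul_left,
      inner_smul_right, inner_smul_left, inner_smul_right, hJ.inner_map_right y x, Complex.conj_conj]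
    linear_combination ht

/-- If T vanishes on K, any isotropic vector serves, which is where dimension two is needed.
Otherwise some eigenvalue is nonzero, isotropy is automatic, and J corrects a negative sign. -/
lemma IsConjugation.exists_eigenvector [FiniteDimensional ℂ E] {J : E →ₛₗ[starRingEnd ℂ] E}
    (hJ : IsConjugation J) {T : E →ₗ[ℂ] E} (hT : T.IsSymmetric) (hTJ : ∀ x, T (J x) = -J (T x))
    {K : Submodule ℂ E} (hKT : ∀ x ∈ K, T x ∈ K) (hKJ : ∀ x ∈ K, J x ∈ K)
    (hK : 2 ≤ Module.finrank ℂ K) :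
    ∃ v ∈ K, ∃ r : ℝ, inner ℂ v v = (1 : ℂ) ∧ inner ℂ v (J v) = 0 ∧ 0 ≤ r ∧ T v = (r : ℂ) • v := by
  suffices h : ∃ v ∈ K, ∃ r : ℝ, v ≠ 0 ∧ inner ℂ v (J v) = 0 ∧ 0 ≤ r ∧ T v = (r : ℂ) • v by
    obtain ⟨v, hvK, r, hv, hvJ, hr, hTv⟩ := h
    refine ⟨((‖v‖⁻¹ : ℝ) : ℂ) • v, K.smul_mem _ hvK, r, ?_, ?_, hr, ?_⟩
    · have hn : ((‖v‖ : ℝ) : ℂ) ≠ 0 := by simpa using hv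
      rw [inner_smul_left, inner_smul_right, inner_self_eq_norm_sq_to_K]
      simp
      field_simp
    · rw [map_smulₛₗ, inner_smul_left, inner_smul_right, hvJ, mul_zero, mul_zero]
    · rw [map_smul, hTv, smul_comm]
  have hS := hT.restrict_invariant hKT
  by_cases hzero : ∀ i, hS.eigenvalues rfl i = 0
  · obtain ⟨v, hvK, hv, hvJ⟩ := hJ.exists_isotropic hK
    refine ⟨v, hvK, 0, hv, hvJ, le_rfl, ?_⟩
    have h0 : T.restrict hKT = 0 := (hS.eigenvectorBasis rfl).toBasis.ext fun i => by
      simp [hS.apply_eigenvectorBasis, hzero]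
    simpa using congrArg Subtype.val (LinearMap.congr_fun h0 ⟨v, hvK⟩)
  · push Not at hzero
    obtain ⟨i, hi⟩ := hzero
    set r := hS.eigenvalues rfl i with hr
    set w := hS.eigenvectorBasis rfl i with hw
    have hw0 : (w : E) ≠ 0 := by
      simpa using (hS.eigenvectorBasis rfl).orthonormal.ne_zero i
    have hTw : T w = (r : ℂ) • (w : E) := by
      exact congrArg Subtype.val (hS.apply_eigenvectorBasis rfl i)
    have hwJ := IsConjugation.inner_map_self_eq_zero hT hTJ hi hTw
    rcases le_total 0 r with h | h
    · exact ⟨w, w.2, r, hw0, hwJ, h, hTw⟩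
    · refine ⟨J w, hKJ _ w.2, -r, fun h0 => hw0 ?_, ?_, by linarith, ?_⟩
      · rw [← hJ.involutive w, h0, map_zero]
      · rw [hJ.inner_map_map, inner_eq_zero_symm, hwJ]
      · rw [hTJ, hTw, map_smulₛₗ]
        simp

/-- Orthonormal families `v` of eigenvectors, orthogonal to their conjugates, of every length up to
half the dimension. -/
lemma IsConjugation.exists_eigenvectors [FiniteDimensional ℂ E] {J : E →ₛₗ[starRingEnd ℂ] E}
    (hJ : IsConjugation J) {T : E →ₗ[ℂ] E} (hT : T.IsSymmetric) (hTJ : ∀ x, T (J x) = -J (T x)) :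
    ∀ k : ℕ, 2 * k ≤ Module.finrank ℂ E → ∃ (v : Fin k → E) (r : Fin k → ℝ),
      (∀ i j, inner ℂ (v i) (v j) = if i = j then (1 : ℂ) else 0) ∧
      (∀ i j, inner ℂ (v i) (J (v j)) = 0) ∧ ∀ i, 0 ≤ r i ∧ T (v i) = (r i : ℂ) • v i := by
  intro k
  induction k with
  | zero => exact fun _ => ⟨Fin.elim0, Fin.elim0, fun i => i.elim0, fun i => i.elim0, fun i => i.elim0⟩
  | succ k ih =>
    intro hk
    obtain ⟨v, r, hvv, hvJ, hv⟩ := ih (by lia)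
    -- F is spanned by 2k vectors, so its orthogonal complement, stable under T and J, still has
    -- dimension at least two.
    set F := Submodule.span ℂ (Set.range (Sum.elim v (J ∘ v))) with hF
    have hmem : ∀ x, x ∈ Fᗮ ↔ ∀ i, inner ℂ (v i) x = 0 ∧ inner ℂ (J (v i)) x = 0 := by
      intro x
      rw [← Submodule.span_singleton_le_iff_mem, Submodule.le_orthogonal_iff_le_orthogonal, hF,
        Submodule.span_le, Set.range_subset_iff]
      simp only [Sum.forall, Sum.elim_inl, Sum.elim_inr, Function.comp_apply, SetLike.mem_coe,
        Submodule.mem_orthogonal_singleton_iff_inner_left, forall_and]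
    have hfin : 2 ≤ Module.finrank ℂ Fᗮ := by
      have h1 := F.finrank_add_finrank_orthogonal
      have h2 : Module.finrank ℂ F ≤ _ := finrank_range_le_card (R := ℂ) (Sum.elim v (J ∘ v))
      rw [Fintype.card_sum, Fintype.card_fin] at h2
      lia
    obtain ⟨w, hwF, s, hww, hwJ, hs, hTw⟩ := hJ.exists_eigenvector hT hTJ (K := Fᗮ)
      (fun x hx => by
        rw [hmem] at hx ⊢
        intro i
        rw [← hT, ← hT, hTJ, (hv i).2, map_smulₛₗ, inner_smul_left, inner_neg_left, inner_smul_left,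
          (hx i).1, (hx i).2]
        simp)
      (fun x hx => by
        rw [hmem] at hx ⊢
        intro i
        rw [hJ.inner_map_map, hJ.inner_map_right, ← inner_conj_symm, (hx i).2, ← inner_conj_symm,
          (hx i).1]
        simp) hfin
    rw [hmem] at hwF
    have hwv : ∀ i, inner ℂ w (v i) = 0 := fun i => by rw [← inner_conj_symm, (hwF i).1, map_zero]
    have hwJv : ∀ i, inner ℂ w (J (v i)) = 0 := fun i => by
      rw [← inner_conj_symm, (hwF i).2, map_zero]
    refine ⟨Fin.cons w v, Fin.cons s r, fun i j => ?_, fun i j => ?_, fun i => ?_⟩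
    · cases i using Fin.cases <;> cases j using Fin.cases <;>
        simp only [Fin.cons_zero, Fin.cons_succ, hww, hvv, hwv, hwF, Fin.succ_inj, Fin.succ_ne_zero,
          (Fin.succ_ne_zero _).symm, if_true, if_false]
    · cases i using Fin.cases <;> cases j using Fin.cases <;> simp [hwJ, hvJ, hwJv]
      rw [hJ.inner_map_right, hwJv]
    · cases i using Fin.cases <;> simp [hs, hTw, hv]

end Conjugation

/-! ### Particle-hole symmetry and the Bogoliubov diagonalization -/

variable {N : ℕ}

/-- The particle-hole conjugation `x ↦ C x̄` on the one-particle space. -/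
noncomputable def particleHole (N : ℕ) :
    EuclideanSpace ℂ (Fin N ⊕ Fin N) →ₛₗ[starRingEnd ℂ] EuclideanSpace ℂ (Fin N ⊕ Fin N) where
  toFun x := WithLp.toLp 2 fun a => star (x a.swap)
  map_add' x y := by ext a; simp
  map_smul' r x := by ext a; simp

lemma particleHole_apply (x : EuclideanSpace ℂ (Fin N ⊕ Fin N)) (a : Fin N ⊕ Fin N) :
    particleHole N x a = star (x a.swap) := rfl

lemma isConjugation_particleHole (N : ℕ) : IsConjugation (particleHole N) where
  involutive x := by ext a; simp [particleHole_apply]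
  inner_map_map x y := by
    simp only [PiLp.inner_apply, particleHole_apply]
    refine Fintype.sum_equiv (Equiv.sumComm _ _) _ _ fun a => ?_
    simp [mul_comm]

/-- The hypothesis is C A C = -Ā, read entrywise. -/
lemma toEuclideanLin_particleHole {A : Matrix (Fin N ⊕ Fin N) (Fin N ⊕ Fin N) ℂ}
    (hA : ∀ a b, A a.swap b.swap = -star (A a b)) (x : EuclideanSpace ℂ (Fin N ⊕ Fin N)) :
    A.toEuclideanLin (particleHole N x) = -particleHole N (A.toEuclideanLin x) := by
  ext a
  simp only [Matrix.toLpLin_apply, PiLp.neg_apply, particleHole_apply, Matrix.mulVec, dotProduct,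
    star_sum, ← Finset.sum_neg_distrib]
  refine Fintype.sum_equiv (Equiv.sumComm _ _) _ _ fun b => ?_
  simp [hA a b]

lemma flip_mul_apply (A : Matrix (Fin N ⊕ Fin N) (Fin N ⊕ Fin N) ℂ) (a b : Fin N ⊕ Fin N) :
    (flip N * A) a b = A a.swap b := by
  rcases a with i | i <;> simp [flip, Matrix.mul_apply, Matrix.one_apply]

lemma mul_flip_apply (A : Matrix (Fin N ⊕ Fin N) (Fin N ⊕ Fin N) ℂ) (a b : Fin N ⊕ Fin N) :
    (A * flip N) a b = A a b.swap := by
  rcases b with i | i <;> simp [flip, Matrix.mul_apply, Matrix.one_apply]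

lemma blockDiag_eq_diagonal (x y : Fin N → ℝ) :
    blockDiag x y = Matrix.diagonal fun k => ((Sum.elim x y k : ℝ) : ℂ) := by
  rw [blockDiag, Matrix.fromBlocks_diagonal]
  congr 1
  ext (k | k) <;> rfl

/-- Every Bogoliubov-de Gennes matrix has a Bogoliubov diagonalization. -/
lemma exists_isDiagonalization {M Δ : Matrix (Fin N) (Fin N) ℂ}
    (hA : (hamiltonianMatrix M Δ).IsHermitian)
    (hswap : ∀ a b, hamiltonianMatrix M Δ a.swap b.swap = -star (hamiltonianMatrix M Δ a b)) :
    ∃ (W : Matrix (Fin N ⊕ Fin N) (Fin N ⊕ Fin N) ℂ) (ε : Fin N → ℝ),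
      IsDiagonalization M Δ W ε := by
  set A := hamiltonianMatrix M Δ with hAdef
  have hJ := isConjugation_particleHole N
  have hTJ := toEuclideanLin_particleHole hswap
  obtain ⟨v₀, r₀, hvv₀, hvJ₀, hv₀⟩ := hJ.exists_eigenvectors
    (Matrix.isSymmetric_toEuclideanLin_iff.mpr hA) hTJ N (by simp [two_mul])
  set τ := Tuple.sort r₀ with hτ
  obtain ⟨v, hvdef⟩ : ∃ v, v = v₀ ∘ τ := ⟨_, rfl⟩
  obtain ⟨r, hrdef⟩ : ∃ r, r = r₀ ∘ τ := ⟨_, rfl⟩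
  have hvv : ∀ i j, inner ℂ (v i) (v j) = if i = j then (1 : ℂ) else 0 := fun i j => by
    simp [hvdef, hvv₀]
  have hvJ : ∀ i j, inner ℂ (v i) (particleHole N (v j)) = 0 := fun i j => by
    simp [hvdef, hvJ₀]
  have hv : ∀ i, 0 ≤ r i ∧ A.toEuclideanLin (v i) = (r i : ℂ) • v i := fun i => by
    simpa [hvdef, hrdef] using hv₀ (τ i)
  have hmono : Monotone r := hrdef ▸ Tuple.monotone_sort r₀
  -- The conjugates come first, to match the block order (-ε, ε); J then acts on the basis by
  -- `Sum.swap`.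
  obtain ⟨u, hu⟩ : ∃ u : Fin N ⊕ Fin N → EuclideanSpace ℂ (Fin N ⊕ Fin N),
      u = Sum.elim (fun i => particleHole N (v i)) v := ⟨_, rfl⟩
  have huu : ∀ a b, inner ℂ (u a) (u b) = if a = b then (1 : ℂ) else 0 := by
    rintro (i | i) (j | j)
    · simp [hu, hJ.inner_map_map, hvv, eq_comm]
    · have := hvJ j i
      rw [← inner_conj_symm, map_eq_zero] at this
      simpa [hu] using this
    · simp [hu, hvJ]
    · simp [hu, hvv]
  have huJ : ∀ a, particleHole N (u a) = u a.swap := by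
    rintro (i | i) <;> simp [hu, hJ.involutive]
  have huA : ∀ a, A.toEuclideanLin (u a) = ((Sum.elim (fun k => -r k) r a : ℝ) : ℂ) • u a := by
    rintro (i | i)
    · simp only [hu, Sum.elim_inl, hTJ, (hv i).2, map_smulₛₗ, Complex.conj_ofReal, Complex.ofReal_neg,
        neg_smul]
    · simp [hu, (hv i).2]
  set U : Matrix (Fin N ⊕ Fin N) (Fin N ⊕ Fin N) ℂ := Matrix.of fun a b => u b a with hU
  have hUU : Uᴴ * U = 1 := by
    ext a b
    rw [Matrix.one_apply, ← huu a b, Matrix.mul_apply, PiLp.inner_apply]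
    simp [hU, mul_comm]
  have hUU' : U * Uᴴ = 1 := mul_eq_one_comm.mp hUU
  have hUA : A * U = U * blockDiag (fun k => -r k) r := by
    ext a b
    rw [blockDiag_eq_diagonal, Matrix.mul_diagonal]
    have := congrArg (fun x : EuclideanSpace ℂ (Fin N ⊕ Fin N) => x a) (huA b)
    simp only [Matrix.toLpLin_apply, Matrix.mulVec, dotProduct, PiLp.smul_apply, smul_eq_mul]
      at this
    rw [mul_comm, Matrix.mul_apply]
    exact this
  have hUC : flip N * conj U = U * flip N := by
    ext a b
    rw [flip_mul_apply, mul_flip_apply]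
    exact congrArg (fun x : EuclideanSpace ℂ (Fin N ⊕ Fin N) => x a) (huJ b)
  have hconj : Uᴴᵀ = conj U := by
    ext a b
    simp [conj]
  refine ⟨Uᴴ, r, ?_, ?_, fun k => (hv k).1, hmono, ?_⟩
  · rw [Matrix.mem_unitaryGroup_iff, Matrix.star_eq_conjTranspose, Matrix.conjTranspose_conjTranspose,
      hUU]
  · have hff : flip N * flip N = 1 := by simp [flip, Matrix.fromBlocks_multiply]
    rw [hconj]
    have : conj U = flip N * U * flip N := by
      rw [mul_assoc, ← hUC, ← mul_assoc, hff, one_mul]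
    rw [this, mul_assoc _ (flip N) (flip N), hff, mul_one, mul_assoc, hUU', mul_one]
  · rw [Matrix.conjTranspose_conjTranspose, ← hUA, mul_assoc, hUU', mul_one]

/-! ### Nambu operators, quasi-particles and the Gibbs state -/

section Operators

variable {ℍ : Type*} [NormedAddCommGroup ℍ] [InnerProductSpace ℂ ℍ]

lemma tr_mul_comm (A B : ℍ →L[ℂ] ℍ) : tr (A * B) = tr (B * A) :=
  LinearMap.trace_mul_comm ℂ (A : ℍ →ₗ[ℂ] ℍ) B

lemma tr_add (A B : ℍ →L[ℂ] ℍ) : tr (A + B) = tr A + tr B := by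
  simp [tr]

lemma tr_smul (r : ℂ) (A : ℍ →L[ℂ] ℍ) : tr (r • A) = r * tr A := by
  simp [tr]

lemma tr_sum {ι : Type*} (s : Finset ι) (A : ι → (ℍ →L[ℂ] ℍ)) :
    tr (∑ i ∈ s, A i) = ∑ i ∈ s, tr (A i) := by
  simp [tr]

variable [CompleteSpace ℍ]

/-- The Nambu vector `(c 1, …, c N, c 1*, …, c N*)`. -/
noncomputable def nambu (c : Fin N → (ℍ →L[ℂ] ℍ)) : Fin N ⊕ Fin N → (ℍ →L[ℂ] ℍ) :=
  Sum.elim c fun i => star (c i)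

lemma star_nambu (c : Fin N → (ℍ →L[ℂ] ℍ)) (a : Fin N ⊕ Fin N) :
    star (nambu c a) = nambu c a.swap := by
  cases a <;> simp [nambu]

lemma SatisfiesCAR.nambu_anticomm {c : Fin N → (ℍ →L[ℂ] ℍ)} (hc : SatisfiesCAR c)
    (a b : Fin N ⊕ Fin N) :
    nambu c a * nambu c b + nambu c b * nambu c a = if a = b.swap then 1 else 0 := by
  rcases a with i | i <;> rcases b with j | j
  · simpa [nambu] using hc.anticomm i j
  · simpa [nambu] using hc.anticomm_mixed i j
  · rw [add_comm]
    simpa [nambu, eq_comm] using hc.anticomm_mixed j i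
  · simpa [nambu] using hc.anticomm_star i j

/-- Hermiticity of M turns ∑ M_ij c_j c_i* into ∑ conj(M_ij) c_i c_j*, the upper left block. -/
lemma hamiltonian_eq_nambu {M : Matrix (Fin N) (Fin N) ℂ} (hM : M.IsHermitian)
    (Δ : Matrix (Fin N) (Fin N) ℂ) (c : Fin N → (ℍ →L[ℂ] ℍ)) :
    hamiltonian M Δ c = (1 / 2 : ℂ) • ∑ a, ∑ b,
      hamiltonianMatrix M Δ a b • (nambu c a * star (nambu c b)) := by
  have hcomm : ∑ i, ∑ j, M i j • (c j * star (c i)) = ∑ i, ∑ j, star (M i j) • (c i * star (c j)) := by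
    rw [Finset.sum_comm]
    refine Finset.sum_congr rfl fun i _ => Finset.sum_congr rfl fun j _ => ?_
    rw [hM.apply]
  rw [hamiltonian, ← smul_add]
  congr 1
  simp only [smul_sub, Finset.sum_sub_distrib, hcomm, Fintype.sum_sum_type, hamiltonianMatrix, nambu,
    Matrix.fromBlocks_apply₁₁, Matrix.fromBlocks_apply₁₂, Matrix.fromBlocks_apply₂₁,
    Matrix.fromBlocks_apply₂₂, Sum.elim_inl, Sum.elim_inr, star_star, conj, Matrix.neg_apply,
    Matrix.map_apply, neg_smul, Finset.sum_add_distrib, Finset.sum_neg_distrib]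
  abel

lemma isHermitian_hamiltonianMatrix {M Δ : Matrix (Fin N) (Fin N) ℂ} (hM : M.IsHermitian)
    (hΔ : Δᵀ = -Δ) : (hamiltonianMatrix M Δ).IsHermitian := by
  have h : ∀ i j, Δ i j = -Δ j i := fun i j => by simpa using congrFun₂ hΔ j i
  ext (i | i) (j | j)
  · simp [hamiltonianMatrix, conj, ← hM.apply i j]
  · simp [hamiltonianMatrix, conj, h j i]
  · simp [hamiltonianMatrix, conj, h j i]
  · simpa [hamiltonianMatrix] using hM.apply i j

/-- The particle-hole antisymmetry of the block matrix of the Hamiltonian. -/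
lemma hamiltonianMatrix_swap {M Δ : Matrix (Fin N) (Fin N) ℂ} (a b : Fin N ⊕ Fin N) :
    hamiltonianMatrix M Δ a.swap b.swap = -star (hamiltonianMatrix M Δ a b) := by
  rcases a with i | i <;> rcases b with j | j <;> simp [hamiltonianMatrix, conj]

lemma isSelfAdjoint_hamiltonian {M Δ : Matrix (Fin N) (Fin N) ℂ} (hM : M.IsHermitian)
    (hΔ : Δᵀ = -Δ) (c : Fin N → (ℍ →L[ℂ] ℍ)) : IsSelfAdjoint (hamiltonian M Δ c) := by
  rw [isSelfAdjoint_iff, hamiltonian_eq_nambu hM, star_smul, star_sum]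
  simp only [star_sum, star_smul, star_mul, star_star]
  rw [Finset.sum_comm]
  simp only [(isHermitian_hamiltonianMatrix hM hΔ).apply]
  congr 1
  simp

/-- Expresses a commutator with a product through anticommutators, which are scalars for Nambu
operators. -/
lemma commutator_mul_eq {R : Type*} [Ring R] (x y z : R) :
    x * y * z - z * (x * y) = x * (y * z + z * y) - (x * z + z * x) * y := by
  noncomm_ring

/-- The commutator of the Hamiltonian with a component of the Nambu vector. -/
lemma SatisfiesCAR.hamiltonian_commutator {c : Fin N → (ℍ →L[ℂ] ℍ)} (hc : SatisfiesCAR c)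
    {M Δ : Matrix (Fin N) (Fin N) ℂ} (hM : M.IsHermitian) (hΔ : Δᵀ = -Δ) (d : Fin N ⊕ Fin N) :
    hamiltonian M Δ c * nambu c d - nambu c d * hamiltonian M Δ c =
      ∑ a, hamiltonianMatrix M Δ a d • nambu c a := by
  have hA := isHermitian_hamiltonianMatrix hM hΔ
  set A := hamiltonianMatrix M Δ with hAdef
  have hterm : ∀ a b, A a b • (nambu c a * star (nambu c b)) * nambu c d -
      nambu c d * A a b • (nambu c a * star (nambu c b)) =
      (if b = d then A a b • nambu c a else 0) -
        (if a = d.swap then A a b • nambu c b.swap else 0) := by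
    intro a b
    rw [smul_mul_assoc, mul_smul_comm, ← smul_sub, commutator_mul_eq, star_nambu,
      hc.nambu_anticomm, hc.nambu_anticomm]
    have : (b.swap = d.swap) ↔ b = d := Sum.swap_rightInverse.injective.eq_iff
    simp only [this]
    split_ifs <;> simp [smul_sub]
  -- Particle-hole antisymmetry makes the two contributions equal, cancelling the factor 1/2.
  have hsecond : ∑ b, A d.swap b • nambu c b.swap = -∑ a, A a d • nambu c a := by
    rw [← Finset.sum_neg_distrib]
    refine Fintype.sum_equiv (Equiv.sumComm _ _) _ _ fun b => ?_
    have := hamiltonianMatrix_swap (M := M) (Δ := Δ) d b.swap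
    rw [Sum.swap_swap, ← hAdef, hA.apply] at this
    simp [this]
  calc _ = (1 / 2 : ℂ) • ∑ a, ∑ b, (A a b • (nambu c a * star (nambu c b)) * nambu c d -
      nambu c d * A a b • (nambu c a * star (nambu c b))) := by
        rw [hamiltonian_eq_nambu hM, smul_mul_assoc, mul_smul_comm, ← smul_sub]
        simp only [Finset.sum_mul, Finset.mul_sum, Finset.sum_sub_distrib, hAdef]
    _ = (1 / 2 : ℂ) • (∑ a, A a d • nambu c a - ∑ b, A d.swap b • nambu c b.swap) := by
        simp only [hterm, Finset.sum_sub_distrib]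
        congr 2
        · simp
        · rw [Finset.sum_comm]
          simp
    _ = _ := by
        rw [hsecond, sub_neg_eq_add, ← two_smul ℂ, smul_smul]
        norm_num

/-- The operators with coefficients in the columns of a matrix `U` with respect to the Nambu
vector. -/
noncomputable def quasi (c : Fin N → (ℍ →L[ℂ] ℍ)) (U : Matrix (Fin N ⊕ Fin N) (Fin N ⊕ Fin N) ℂ)
    (k : Fin N ⊕ Fin N) : ℍ →L[ℂ] ℍ :=
  ∑ d, U d k • nambu c d

/-- Unitarity suffices, since {ψ_d, ψ_e*} = δ_de holds for the whole Nambu vector. -/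
lemma SatisfiesCAR.quasi_anticomm {c : Fin N → (ℍ →L[ℂ] ℍ)} (hc : SatisfiesCAR c)
    {U : Matrix (Fin N ⊕ Fin N) (Fin N ⊕ Fin N) ℂ} (hU : Uᴴ * U = 1) (k l : Fin N ⊕ Fin N) :
    quasi c U k * star (quasi c U l) + star (quasi c U l) * quasi c U k =
      if k = l then 1 else 0 := by
  have h : ∀ d e, nambu c d * star (nambu c e) + star (nambu c e) * nambu c d =
      if d = e then 1 else 0 := fun d e => by rw [star_nambu, hc.nambu_anticomm, Sum.swap_swap]
  simp only [quasi, star_sum, star_smul, Finset.sum_mul_sum]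
  rw [Finset.sum_comm (f := fun e d => (star (U e l) • star (nambu c e)) * (U d k • nambu c d))]
  simp only [← Finset.sum_add_distrib]
  have h2 : ∀ d e, (U d k • nambu c d) * (star (U e l) • star (nambu c e)) +
      (star (U e l) • star (nambu c e)) * (U d k • nambu c d) =
      if d = e then (star (U e l) * U d k) • 1 else 0 := by
    intro d e
    rw [smul_mul_smul_comm, smul_mul_smul_comm, mul_comm (U d k), ← smul_add, h]
    split_ifs <;> simp
  simp only [h2, Finset.sum_ite_eq, Finset.mem_univ, if_true, ← Finset.sum_smul]
  have h3 := congrFun₂ hU l k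
  rw [Matrix.mul_apply] at h3
  simp only [Matrix.conjTranspose_apply] at h3
  rw [h3, Matrix.one_apply]
  simp [eq_comm]

lemma SatisfiesCAR.hamiltonian_quasi {c : Fin N → (ℍ →L[ℂ] ℍ)} (hc : SatisfiesCAR c)
    {M Δ : Matrix (Fin N) (Fin N) ℂ} (hM : M.IsHermitian) (hΔ : Δᵀ = -Δ)
    {U : Matrix (Fin N ⊕ Fin N) (Fin N ⊕ Fin N) ℂ} {D : Fin N ⊕ Fin N → ℂ}
    (hU : hamiltonianMatrix M Δ * U = U * Matrix.diagonal D) (k : Fin N ⊕ Fin N) :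
    hamiltonian M Δ c * quasi c U k = quasi c U k * hamiltonian M Δ c + D k • quasi c U k := by
  rw [← sub_eq_iff_eq_add']
  calc _ = ∑ d, U d k • (hamiltonian M Δ c * nambu c d - nambu c d * hamiltonian M Δ c) := by
        simp only [quasi, Finset.mul_sum, Finset.sum_mul, smul_sub, Finset.sum_sub_distrib,
          mul_smul_comm, smul_mul_assoc]
    _ = ∑ a, (hamiltonianMatrix M Δ * U) a k • nambu c a := by
        simp only [hc.hamiltonian_commutator hM hΔ, Finset.smul_sum, smul_smul]
        rw [Finset.sum_comm]
        simp only [← Finset.sum_smul, Matrix.mul_apply, mul_comm]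
    _ = _ := by
        simp [hU, Matrix.mul_diagonal, quasi, Finset.smul_sum, smul_smul, mul_comm]

/-- The hypothesis says that `x` intertwines H + r with H, hence also their exponentials, and the
scalar r factors out. -/
lemma exp_mul_of_mul_eq {H x : ℍ →L[ℂ] ℍ} {r : ℂ} (h : H * x = x * H + r • x) (t : ℂ) :
    NormedSpace.exp (t • H) * x = Complex.exp (t * r) • (x * NormedSpace.exp (t • H)) := by
  let _ : NormedAlgebra ℚ (ℍ →L[ℂ] ℍ) := NormedAlgebra.restrictScalars ℚ ℂ _
  have hsemi : SemiconjBy x (t • H + algebraMap ℂ _ (t * r)) (t • H) := by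
    simp [SemiconjBy, h, Algebra.algebraMap_eq_smul_one, mul_add, smul_add, smul_smul]
  have h1 := hsemi.exp_right
  rw [NormedSpace.exp_add_of_commute (Algebra.commutes _ _).symm,
    ← NormedSpace.algebraMap_exp_comm, ← Complex.exp_eq_exp_ℂ] at h1
  rw [← h1.eq, Algebra.algebraMap_eq_smul_one]
  simp

/-- With Y = exp(H/2) invertible and self-adjoint, the trace of Y*Y is a nonempty sum of positive
terms ‖Y b_i‖². -/
lemma tr_exp_ne_zero [FiniteDimensional ℂ ℍ] [Nontrivial ℍ] {H : ℍ →L[ℂ] ℍ}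
    (hH : IsSelfAdjoint H) : tr (NormedSpace.exp H) ≠ 0 := by
  let _ : NormedAlgebra ℚ (ℍ →L[ℂ] ℍ) := NormedAlgebra.restrictScalars ℚ ℂ _
  set K := (1 / 2 : ℂ) • H with hK
  set Y := NormedSpace.exp K with hY
  have hKsa : star K = K := by rw [hK, star_smul, hH.star_eq]; simp
  have hYY : NormedSpace.exp H = star Y * Y := by
    rw [hY, NormedSpace.star_exp, hKsa, ← NormedSpace.exp_add_of_commute (Commute.refl K), hK,
      ← add_smul]
    norm_num
  have hunit : IsUnit Y := NormedSpace.isUnit_exp K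
  obtain ⟨Z, hZ⟩ := hunit.exists_left_inv
  let b := stdOrthonormalBasis ℂ ℍ
  have htr : tr (NormedSpace.exp H) = ((∑ i, ‖Y (b i)‖ ^ 2 : ℝ) : ℂ) := by
    rw [tr, LinearMap.trace_eq_sum_inner _ b, hYY, Complex.ofReal_sum]
    refine Finset.sum_congr rfl fun i _ => ?_
    change inner ℂ (b i) ((star Y) (Y (b i))) = _
    rw [ContinuousLinearMap.star_eq_adjoint, ContinuousLinearMap.adjoint_inner_right,
      inner_self_eq_norm_sq_to_K]
    simp
  rw [htr, Complex.ofReal_ne_zero]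
  refine (Finset.sum_pos (fun i _ => ?_) ?_).ne'
  · have : Y (b i) ≠ 0 := fun h0 => by
      have h1 : Z (Y (b i)) = b i := congrArg (fun f : ℍ →L[ℂ] ℍ => f (b i)) hZ
      rw [h0, map_zero] at h1
      exact b.orthonormal.ne_zero i h1.symm
    positivity
  · have : 0 < Module.finrank ℂ ℍ := Module.finrank_pos
    exact ⟨⟨0, this⟩, Finset.mem_univ _⟩

lemma twoPoint_apply (ρ : ℍ →L[ℂ] ℍ) (c : Fin N → (ℍ →L[ℂ] ℍ)) (a b : Fin N ⊕ Fin N) :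
    twoPoint ρ c a b = tr (ρ * (nambu c a * star (nambu c b))) := by
  rcases a with i | i <;> rcases b with j | j <;> simp [twoPoint, nambu, expectation]

lemma tr_mul_quasi (ρ : ℍ →L[ℂ] ℍ) (c : Fin N → (ℍ →L[ℂ] ℍ))
    (U : Matrix (Fin N ⊕ Fin N) (Fin N ⊕ Fin N) ℂ) (k l : Fin N ⊕ Fin N) :
    tr (ρ * (quasi c U k * star (quasi c U l))) = (Uᵀ * twoPoint ρ c * conj U) k l := by
  simp only [quasi, star_sum, star_smul, Finset.mul_sum, tr_sum, Matrix.mul_apply,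
    twoPoint_apply, Finset.sum_mul, smul_mul_assoc, mul_smul_comm, tr_smul, conj,
    Matrix.map_apply, Matrix.transpose_apply]
  exact Finset.sum_congr rfl fun d _ => Finset.sum_congr rfl fun e _ => by ring

/-- The two-point function of quasi-particles in the Gibbs state. -/
lemma SatisfiesCAR.tr_gibbs_mul_quasi [FiniteDimensional ℂ ℍ] [Nontrivial ℍ]
    {c : Fin N → (ℍ →L[ℂ] ℍ)} (hc : SatisfiesCAR c)
    {M Δ : Matrix (Fin N) (Fin N) ℂ} (hM : M.IsHermitian) (hΔ : Δᵀ = -Δ)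
    {U : Matrix (Fin N ⊕ Fin N) (Fin N ⊕ Fin N) ℂ} (hUU : Uᴴ * U = 1) {D : Fin N ⊕ Fin N → ℝ}
    (hU : hamiltonianMatrix M Δ * U = U * Matrix.diagonal fun k => (D k : ℂ)) (β : ℝ)
    (k l : Fin N ⊕ Fin N) :
    tr (gibbs β (hamiltonian M Δ c) * (quasi c U k * star (quasi c U l))) =
      if k = l then (Real.sigmoid (-(β * D k)) : ℂ) else 0 := by
  set H := hamiltonian M Δ c with hH
  set X := NormedSpace.exp (-(β : ℂ) • H) with hX
  set x := quasi c U k with hx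
  set y := star (quasi c U l) with hy
  have hsa : IsSelfAdjoint (-(β : ℂ) • H) := by
    have hHsa : IsSelfAdjoint H := isSelfAdjoint_hamiltonian hM hΔ c
    rw [isSelfAdjoint_iff, star_smul, hHsa.star_eq]
    simp
  have hZ : tr X ≠ 0 := tr_exp_ne_zero hsa
  have hXx : X * x = Complex.exp (-(β : ℂ) * D k) • (x * X) :=
    exp_mul_of_mul_eq (hc.hamiltonian_quasi hM hΔ hU k) _
  -- The KMS relation; with the anticommutator below it determines the expectation.
  have hcyc : tr (X * (x * y)) = Complex.exp (-(β : ℂ) * D k) * tr (X * (y * x)) := by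
    rw [← mul_assoc, hXx, smul_mul_assoc, tr_smul, mul_assoc, tr_mul_comm x, mul_assoc]
  have hsum : tr (X * (x * y)) + tr (X * (y * x)) = if k = l then tr X else 0 := by
    rw [← tr_add, ← mul_add, hc.quasi_anticomm hUU]
    split_ifs <;> simp [tr]
  have hexp : Complex.exp (-(β : ℂ) * D k) = ((Real.exp (-(β * D k)) : ℝ) : ℂ) := by
    push_cast
    ring_nf
  have hpos := Real.exp_pos (-(β * D k))
  rw [hexp] at hcyc
  set q := Real.exp (-(β * D k)) with hq
  have hσ : Real.sigmoid (-(β * D k)) = q / (1 + q) := by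
    rw [Real.sigmoid_def, neg_neg, hq, Real.exp_neg]
    have := Real.exp_pos (β * D k)
    field_simp
    ring
  have hq1 : (1 + (q : ℂ)) ≠ 0 := by
    exact_mod_cast (by positivity : (1 + q) ≠ 0)
  have hkey : (1 + (q : ℂ)) * tr (X * (x * y)) = if k = l then q * tr X else 0 := by
    have : (1 + (q : ℂ)) * tr (X * (x * y)) =
        q * (tr (X * (x * y)) + tr (X * (y * x))) := by
      linear_combination hcyc
    rw [this, hsum]
    split_ifs <;> simp
  rw [gibbs, smul_mul_assoc, tr_smul, ← hX, hσ]
  rw [mul_comm, ← eq_div_iff hq1] at hkey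
  rw [hkey]
  split_ifs
  · push_cast
    field_simp
  · simp

end Operators

/-! ### Functional calculus and the two-point matrix -/

/-- The functional calculus of a matrix given by any unitary diagonalization. -/
lemma cfc_conj_diagonal {n : Type*} [Fintype n] [DecidableEq n] (f : ℝ → ℝ) {V : Matrix n n ℂ}
    (hV : Vᴴ * V = 1) (d : n → ℝ) :
    cfc f (V * Matrix.diagonal (fun k => (d k : ℂ)) * Vᴴ) =
      V * Matrix.diagonal (fun k => (f (d k) : ℂ)) * Vᴴ := by
  have hV' : V * Vᴴ = 1 := mul_eq_one_comm.mp hV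
  have hA : (V * Matrix.diagonal (fun k => (d k : ℂ)) * Vᴴ).IsHermitian := by
    refine Matrix.isHermitian_mul_mul_conjTranspose V ?_
    exact Matrix.isHermitian_diagonal_of_self_adjoint _ (by ext; simp)
  rw [hA.cfc_eq, Matrix.IsHermitian.cfc]
  have hspec := hA.spectral_theorem
  rw [Unitary.conjStarAlgAut_apply] at hspec ⊢
  set e := hA.eigenvalues with he
  obtain ⟨U, hU⟩ : ∃ U : Matrix n n ℂ, U = hA.eigenvectorUnitary := ⟨_, rfl⟩
  have hUU : star U * U = 1 := by rw [hU]; exact Unitary.coe_star_mul_self _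
  have hUU' : U * star U = 1 := mul_eq_one_comm.mp hUU
  rw [← hU] at hspec ⊢
  -- The transition matrix between the two eigenbases has a nonzero (i, j) entry only if e_i = d_j,
  -- so it also intertwines f(e) and f(d).
  have hQ : Matrix.diagonal (fun k => (e k : ℂ)) * (star U * V) =
      (star U * V) * Matrix.diagonal (fun k => (d k : ℂ)) := by
    calc _ = star U * (U * Matrix.diagonal (fun k => (e k : ℂ)) * star U) * V := by
          simp only [← mul_assoc, hUU, one_mul]
      _ = star U * (V * Matrix.diagonal (fun k => (d k : ℂ)) * Vᴴ) * V := by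
          rw [hspec]
          rfl
      _ = _ := by simp only [mul_assoc, hV, mul_one]
  have hfQ : Matrix.diagonal (fun k => (f (e k) : ℂ)) * (star U * V) =
      (star U * V) * Matrix.diagonal (fun k => (f (d k) : ℂ)) := by
    ext i j
    have h := congrFun₂ hQ i j
    rw [Matrix.diagonal_mul, Matrix.mul_diagonal] at h ⊢
    by_cases h0 : (star U * V) i j = 0
    · simp [h0]
    · rw [mul_comm] at h
      rw [Complex.ofReal_inj.mp (mul_left_cancel₀ h0 h), mul_comm]
  calc _ = U * (Matrix.diagonal (fun k => (f (e k) : ℂ)) * (star U * V)) * Vᴴ := by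
        simp only [mul_assoc, hV', mul_one]
        rfl
    _ = _ := by
        rw [hfQ]
        simp only [← mul_assoc, hUU', one_mul]

lemma conj_mul {n : Type*} [Fintype n] (A B : Matrix n n ℂ) : conj (A * B) = conj A * conj B :=
  Matrix.map_mul (f := starRingEnd ℂ)

lemma conj_conj {n : Type*} (A : Matrix n n ℂ) : conj (conj A) = A := by
  ext
  simp [conj]

lemma conj_one {n : Type*} [DecidableEq n] : conj (1 : Matrix n n ℂ) = 1 := by
  simp [conj]

lemma conj_conjTranspose {n : Type*} (A : Matrix n n ℂ) : conj Aᴴ = (conj A)ᴴ := rfl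

lemma conj_blockDiag (x y : Fin N → ℝ) : conj (blockDiag x y) = blockDiag x y := by
  simp [blockDiag, conj]

lemma conj_flip (N : ℕ) : conj (flip N) = flip N := by
  simp [flip, conj, Matrix.fromBlocks_map]

lemma flip_mul_blockDiag_mul_flip (x y : Fin N → ℝ) :
    flip N * blockDiag x y * flip N = blockDiag y x := by
  simp only [flip, blockDiag, Matrix.fromBlocks_multiply]
  simp

lemma IsDiagonalization.mul_conjTranspose {M Δ : Matrix (Fin N) (Fin N) ℂ}
    {W : Matrix (Fin N ⊕ Fin N) (Fin N ⊕ Fin N) ℂ} {ε : Fin N → ℝ}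
    (h : IsDiagonalization M Δ W ε) : W * Wᴴ = 1 :=
  Matrix.mem_unitaryGroup_iff.mp h.unitary

lemma IsDiagonalization.conj_mul_conjTranspose {M Δ : Matrix (Fin N) (Fin N) ℂ}
    {W : Matrix (Fin N ⊕ Fin N) (Fin N ⊕ Fin N) ℂ} {ε : Fin N → ℝ}
    (h : IsDiagonalization M Δ W ε) : conj W * (conj W)ᴴ = 1 := by
  rw [← conj_conjTranspose, ← conj_mul, h.mul_conjTranspose, conj_one]

/-- Unitarity makes Wᵀ the inverse of W̄, so orthogonality becomes a rule for moving C past W. -/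
lemma IsDiagonalization.conj_mul_flip {M Δ : Matrix (Fin N) (Fin N) ℂ}
    {W : Matrix (Fin N ⊕ Fin N) (Fin N ⊕ Fin N) ℂ} {ε : Fin N → ℝ}
    (h : IsDiagonalization M Δ W ε) : conj W * flip N = flip N * W := by
  have hT : conj W * Wᵀ = 1 := h.conj_mul_conjTranspose ▸ by
    congr 1
    ext
    simp [conj]
  calc conj W * flip N = conj W * (Wᵀ * flip N * W) := by rw [h.orthogonal]
    _ = flip N * W := by rw [← mul_assoc, ← mul_assoc, hT, one_mul]

/-- The two-point matrix of the Gibbs state in terms of a Bogoliubov diagonalization. -/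
lemma IsDiagonalization.twoPoint_gibbs {ℍ : Type*} [NormedAddCommGroup ℍ] [InnerProductSpace ℂ ℍ]
    [CompleteSpace ℍ] [FiniteDimensional ℂ ℍ] [Nontrivial ℍ] {c : Fin N → (ℍ →L[ℂ] ℍ)}
    (hc : SatisfiesCAR c) {M Δ : Matrix (Fin N) (Fin N) ℂ} (hM : M.IsHermitian) (hΔ : Δᵀ = -Δ)
    {W : Matrix (Fin N ⊕ Fin N) (Fin N ⊕ Fin N) ℂ} {ε : Fin N → ℝ}
    (h : IsDiagonalization M Δ W ε) (β : ℝ) :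
    twoPoint (gibbs β (hamiltonian M Δ c)) c = (conj W)ᴴ *
      blockDiag (fun k => Real.sigmoid (β * ε k)) (fun k => Real.sigmoid (-(β * ε k))) *
      conj W := by
  set S := twoPoint (gibbs β (hamiltonian M Δ c)) c with hS
  have hWW := h.mul_conjTranspose
  have hWW' := h.conj_mul_conjTranspose
  have hWWc : (conj W)ᴴ * conj W = 1 := mul_eq_one_comm.mp hWW'
  have hU : hamiltonianMatrix M Δ * Wᴴ =
      Wᴴ * Matrix.diagonal fun k => ((Sum.elim (fun k => -ε k) ε k : ℝ) : ℂ) := by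
    rw [h.eq, mul_assoc, hWW, mul_one, blockDiag_eq_diagonal]
  have hG : conj W * S * (conj W)ᴴ = blockDiag (fun k => Real.sigmoid (β * ε k))
      (fun k => Real.sigmoid (-(β * ε k))) := by
    ext k l
    have h1 := hc.tr_gibbs_mul_quasi hM hΔ (by rw [Matrix.conjTranspose_conjTranspose, hWW]) hU β k l
    rw [tr_mul_quasi] at h1
    rw [blockDiag_eq_diagonal, Matrix.diagonal_apply]
    refine h1.trans ?_
    rcases k with k | k <;> simp
  rw [← hG]
  simp only [← mul_assoc, hWWc, one_mul]
  rw [mul_assoc, hWWc, mul_one]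

end BdG

/-! ### The main theorem -/

theorem mainTheorem5 {ℍ : Type*} [NormedAddCommGroup ℍ] [InnerProductSpace ℂ ℍ] [CompleteSpace ℍ]
    [FiniteDimensional ℂ ℍ] [Nontrivial ℍ] {N : ℕ}
    (c : Fin N → (ℍ →L[ℂ] ℍ)) (hc : BdG.SatisfiesCAR c)
    (M Δ : Matrix (Fin N) (Fin N) ℂ) (hM : M.IsHermitian) (hΔ : Δᵀ = -Δ)
    (β : ℝ) (hβ : 0 < β)
    (S : Matrix (Fin N ⊕ Fin N) (Fin N ⊕ Fin N) ℂ)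
    (hS : S = BdG.twoPoint (BdG.gibbs β (BdG.hamiltonian M Δ c)) c) :
    (∃ (W : Matrix (Fin N ⊕ Fin N) (Fin N ⊕ Fin N) ℂ) (ε : Fin N → ℝ),
      BdG.IsDiagonalization M Δ W ε) ∧
    (∀ (W : Matrix (Fin N ⊕ Fin N) (Fin N ⊕ Fin N) ℂ) (ε : Fin N → ℝ),
      BdG.IsDiagonalization M Δ W ε →
        S = (BdG.conj W)ᴴ *
          BdG.blockDiag (fun k => Real.sigmoid (β * ε k)) (fun k => Real.sigmoid (-(β * ε k))) *
          BdG.conj W) ∧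
    S = cfc Real.sigmoid (-β • BdG.conj (BdG.hamiltonianMatrix M Δ)) ∧
    S.PosSemidef ∧ (1 - S).PosSemidef ∧
    BdG.flip N * BdG.conj S * BdG.flip N = 1 - S := by
  open BdG in
  have hex := exists_isDiagonalization (isHermitian_hamiltonianMatrix hM hΔ)
    (hamiltonianMatrix_swap (M := M) (Δ := Δ))
  have hdiag : ∀ W ε, IsDiagonalization M Δ W ε → _ := fun W ε h =>
    hS.trans (h.twoPoint_gibbs hc hM hΔ β)
  refine ⟨hex, hdiag, ?_⟩
  obtain ⟨W, ε, h⟩ := hex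
  have hSW := hdiag W ε h
  have hVV : conj W * (conj W)ᴴ = 1 := h.conj_mul_conjTranspose
  have hVV' : (conj W)ᴴ * conj W = 1 := mul_eq_one_comm.mp hVV
  -- Since 1 - σ(x) = σ(-x), complementation exchanges the two diagonal blocks, as conjugation by C
  -- does.
  have hσ : (1 : Matrix (Fin N ⊕ Fin N) (Fin N ⊕ Fin N) ℂ) -
      blockDiag (fun k => Real.sigmoid (β * ε k)) (fun k => Real.sigmoid (-(β * ε k))) =
      blockDiag (fun k => Real.sigmoid (-(β * ε k))) (fun k => Real.sigmoid (β * ε k)) := by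
    rw [blockDiag_eq_diagonal, blockDiag_eq_diagonal, ← Matrix.diagonal_one, Matrix.diagonal_sub]
    congr 1
    ext (k | k) <;> simp [Real.sigmoid_neg]
  have hone : 1 - S = (conj W)ᴴ *
      blockDiag (fun k => Real.sigmoid (-(β * ε k))) (fun k => Real.sigmoid (β * ε k)) *
      conj W := by
    rw [← hσ, mul_sub, sub_mul, mul_one, hVV', ← hSW]
  have hpos : ∀ x y : Fin N → ℝ, (∀ k, 0 ≤ x k) → (∀ k, 0 ≤ y k) →
      ((conj W)ᴴ * blockDiag x y * conj W).PosSemidef := by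
    intro x y hx hy
    refine Matrix.PosSemidef.conjTranspose_mul_mul_same ?_ _
    rw [blockDiag_eq_diagonal, Matrix.posSemidef_diagonal_iff]
    rintro (k | k)
    · exact Complex.zero_le_real.mpr (hx k)
    · exact Complex.zero_le_real.mpr (hy k)
  refine ⟨?_, ?_, ?_, ?_⟩
  · have harg : -β • conj (hamiltonianMatrix M Δ) = (conj W)ᴴ *
        Matrix.diagonal (fun k => ((Sum.elim (fun k => β * ε k) (fun k => -(β * ε k)) k : ℝ) : ℂ)) *
        (conj W)ᴴᴴ := by
      rw [Matrix.conjTranspose_conjTranspose, h.eq, BdG.conj_mul, BdG.conj_mul, conj_blockDiag,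
        conj_conjTranspose, ← smul_mul_assoc, ← mul_smul_comm, blockDiag_eq_diagonal,
        ← Matrix.diagonal_smul]
      congr 3
      ext (k | k) <;> simp
    rw [harg, cfc_conj_diagonal _ (by rw [Matrix.conjTranspose_conjTranspose, hVV]),
      Matrix.conjTranspose_conjTranspose, hSW, blockDiag_eq_diagonal]
    congr 3
    ext (k | k) <;> rfl
  · rw [hSW]
    exact hpos _ _ (fun k => Real.sigmoid_nonneg _) (fun k => Real.sigmoid_nonneg _)
  · rw [hone]
    exact hpos _ _ (fun k => Real.sigmoid_nonneg _) (fun k => Real.sigmoid_nonneg _)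
  · have hCW : conj W * BdG.flip N = BdG.flip N * W := h.conj_mul_flip
    have hWC : W * BdG.flip N = BdG.flip N * conj W := by
      simpa [BdG.conj_mul, conj_conj, conj_flip] using congrArg conj hCW
    have hCW' : BdG.flip N * Wᴴ = (conj W)ᴴ * BdG.flip N := by
      have hf : (BdG.flip N)ᴴ = BdG.flip N := by simp [BdG.flip, Matrix.fromBlocks_conjTranspose]
      simpa [hf] using congrArg Matrix.conjTranspose hWC
    rw [hone, hSW, BdG.conj_mul, BdG.conj_mul, conj_blockDiag, conj_conjTranspose, conj_conj,
      ← flip_mul_blockDiag_mul_flip (fun k => Real.sigmoid (β * ε k))]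
    calc _ = (BdG.flip N * Wᴴ) * blockDiag (fun k => Real.sigmoid (β * ε k))
          (fun k => Real.sigmoid (-(β * ε k))) * (W * BdG.flip N) := by simp only [mul_assoc]
      _ = _ := by rw [hCW', hWC]; simp only [mul_assoc]
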